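/- Let $k\ge 1$ be a fixed integer and let $$p=p(n)=\frac{\log n+(k+1)\log\log n-\log\log\log n}{n},$$ where $\log$ is the natural logarithm. Let $G(n,p)$ be the random graph on $n$ labelled vertices in which each of the $\binom n2$ possible edges is present independently with probability $p$, and let $\kappa(G)$ denote the vertex connectivity of a graph $G$, i.e. the least number of vertices whose deletion leaves a graph that is disconnected or has at most one vertex. Then $k\le\kappa(G(n,p))\le k+1$ almost surely, that is, $$\Pr\bigl[k\le\kappa(G(n,p))\le k+1\bigr]\to 1\qquad (n\to\infty).$$ -/

import Mathlib

open Filter Topology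

/-- The vertex connectivity `κ(G)` of a finite graph: the least number of vertices whose deletion
leaves a graph that is disconnected or has at most one vertex (so `κ(K_n) = n - 1` for `n ≥ 1`). -/
noncomputable def vertexConnectivity {V : Type*} [Fintype V] (G : SimpleGraph V) : ℕ :=
  sInf {m : ℕ | ∃ S : Finset V, S.card = m ∧
    (¬ (G.induce ((S : Set V)ᶜ)).Connected ∨ ((S : Set V)ᶜ).Subsingleton)}

/-- The real number `(log n + (k + 1) log log n - log log log n) / n`. -/
noncomputable def edgeDensity (k n : ℕ) : ℝ :=
  (Real.log n + (k + 1) * Real.log (Real.log n) - Real.log (Real.log (Real.log n))) / n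

/-- The edge probability `p(n) = (log n + (k + 1) log log n - log log log n) / n`. For each fixed
`k` the value lies in `[0, 1]` for all large `n`; the projection onto `[0, 1]` only acts on the
finitely many other `n`. -/
noncomputable def edgeProb (k n : ℕ) : unitInterval :=
  Set.projIcc (0 : ℝ) 1 zero_le_one (edgeDensity k n)

/-! Write `x = n * p`, so that `exp (-x) = log log n / (n * (log n)^(k+1))`.

Lower bound: if `κ < k`, some nonempty `A`, no larger than the rest of the graph outside its
neighbourhood, has an outer neighbourhood `S` with `s < k` vertices. With `a = |A|`, a union bound
gives terms `C(n,a) C(n,s) (a p)^s (1-p)^(a(n-s-a))`. While `a log n ≤ 6n`, such a term is at most a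
constant times `(log n)^(k-1) r^a`, where `r` is of order `log log n / (log n)^(k+1)`; the geometric
sum tends to 0. For larger `a` the absent edges cost `exp (-2n)`, which beats the at most `2^n`
choices of `A`.

Upper bound: a vertex of degree `k+1` gives `κ ≤ k+1`. Restricted to one half of the vertices with
all neighbours in the other half, the expected number of such vertices is still at least a constant
times `log log n`. The events are nearly independent, so a second moment argument yields one with
probability tending to 1. -/

/-! ### Probabilities of prescribed present and absent edges -/

section EdgeEvents

open MeasureTheory ProbabilityTheory unitInterval

/-- The event that all edges in `E` are present and all edges in `F` are absent. -/
def edgePattern {V : Type*} (E F : Finset (Sym2 V)) : Set (SimpleGraph V) :=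
  {G | (∀ e ∈ E, e ∈ G.edgeSet) ∧ ∀ e ∈ F, e ∉ G.edgeSet}

theorem measurableSet_simpleGraph {V : Type*} [Finite V] (S : Set (SimpleGraph V)) :
    MeasurableSet S := by
  rw [← Set.preimage_image_eq S SimpleGraph.edgeSet_injective]
  exact SimpleGraph.measurable_edgeSet (Set.toFinite _).measurableSet

/-- The event is a cylinder in the product of Bernoulli coordinates. Disjointness makes the
prescription consistent; loops are excluded because `fromEdgeSet` discards them. -/
theorem binomialRandom_real_edgePattern {V : Type*} [Finite V] (p : I)
    {E F : Finset (Sym2 V)} (hEF : Disjoint E F)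
    (hE : ∀ e ∈ E, ¬ e.IsDiag) (hF : ∀ e ∈ F, ¬ e.IsDiag) :
    (SimpleGraph.binomialRandom V p).real (edgePattern E F)
      = (p : ℝ) ^ E.card * (1 - p) ^ F.card := by
  classical
  have hmeas : MeasurableSet (edgePattern E F) := measurableSet_simpleGraph _
  rw [SimpleGraph.binomialRandom_eq_map, measureReal_def,
    Measure.map_apply SimpleGraph.measurable_fromEdgeSet hmeas, setBernoulli_apply']
  have hset : ((fun q : Sym2 V → Prop ↦ {i | q i}) ⁻¹'
      (SimpleGraph.fromEdgeSet ⁻¹' edgePattern E F)) =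
      Set.pi (↑(E ∪ F) : Set (Sym2 V))
        (fun e ↦ if e ∈ E then ({True} : Set Prop) else {False}) := by
    ext q
    simp only [Set.mem_preimage, edgePattern, Set.mem_ofPred_eq, SimpleGraph.edgeSet_fromEdgeSet,
      Set.mem_sdiff, Set.mem_pi, Finset.coe_union, Set.mem_union, Finset.mem_coe]
    constructor
    · rintro ⟨h1, h2⟩ e he
      by_cases heE : e ∈ E
      · simpa [heE] using (h1 e heE).1
      · have heF := he.resolve_left heE
        have := h2 e heF
        have hd := hF e heF
        simp only [heE, if_false, Set.mem_singleton_iff, eq_iff_iff, iff_false]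
        exact fun hq => this ⟨hq, by simpa using hd⟩
    · intro h
      refine ⟨fun e he => ⟨?_, by simpa using hE e he⟩, fun e he hq => ?_⟩
      · simpa [he] using h e (Or.inl he)
      · have heE : e ∉ E := Finset.disjoint_right.1 hEF he
        have := h e (Or.inr he)
        simp only [heE, if_false, Set.mem_singleton_iff, eq_iff_iff, iff_false] at this
        exact this hq.1
  rw [hset, Measure.infinitePi_pi _ (fun _ _ => by measurability), Finset.prod_union hEF,
    Finset.prod_congr (g := fun _ => ((toNNReal p : NNReal) : ENNReal)) rfl,
    Finset.prod_congr (s₁ := F) (g := fun _ => ((toNNReal (σ p) : NNReal) : ENNReal)) rfl]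
  · simp
  · intro e he
    have heE : e ∉ E := Finset.disjoint_right.1 hEF he
    have hd : (e ∈ (Sym2.diagSet : Set (Sym2 V))ᶜ) = True := by simpa using hF e he
    rw [hd]
    simp [heE]
  · intro e he
    have hd : (e ∈ (Sym2.diagSet : Set (Sym2 V))ᶜ) = True := by simpa using hE e he
    rw [hd]
    simp [he]

end EdgeEvents

/-! ### Second moment method -/

section SecondMoment

open MeasureTheory

/-- A second moment bound: if `M` is the expected number of occurring events and the correlation
sum is at most `M + (1 + ε) M²`, then no event occurs with probability at most `1 / M + ε`. -/
theorem measureReal_forall_notMem_le {Ω ι : Type*} [MeasurableSpace Ω] (μ : Measure Ω)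
    [IsProbabilityMeasure μ] (s : Finset ι) (B : ι → Set Ω) (hB : ∀ i ∈ s, MeasurableSet (B i))
    {M ε : ℝ} (hM : 0 < M) (hsum : ∑ i ∈ s, μ.real (B i) = M)
    (hcorr : ∑ i ∈ s, ∑ j ∈ s, μ.real (B i ∩ B j) ≤ M + (1 + ε) * M ^ 2) :
    μ.real {ω | ∀ i ∈ s, ω ∉ B i} ≤ 1 / M + ε := by
  classical
  set X : Ω → ℝ := fun ω => ∑ i ∈ s, (B i).indicator (fun _ => (1 : ℝ)) ω with hX
  have hint : ∀ A : Set Ω, MeasurableSet A → Integrable (A.indicator fun _ => (1 : ℝ)) μ :=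
    fun A hA => (integrable_const _).indicator hA
  have hXi : Integrable X μ := integrable_finsetSum _ fun i hi => hint _ (hB i hi)
  have hXsq : ∀ ω, X ω ^ 2
      = ∑ i ∈ s, ∑ j ∈ s, (B i ∩ B j).indicator (fun _ => (1 : ℝ)) ω := by
    intro ω
    rw [sq, hX, Finset.sum_mul_sum]
    refine Finset.sum_congr rfl fun i _ => Finset.sum_congr rfl fun j _ => ?_
    by_cases h1 : ω ∈ B i <;> by_cases h2 : ω ∈ B j <;> simp [h1, h2]
  have hXsqi : Integrable (fun ω => X ω ^ 2) μ := by
    simp_rw [hXsq]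
    exact integrable_finsetSum _ fun i hi => integrable_finsetSum _ fun j hj =>
      hint _ ((hB i hi).inter (hB j hj))
  have hEX : ∫ ω, X ω ∂μ = M := by
    rw [hX, integral_finsetSum _ fun i hi => hint _ (hB i hi), ← hsum]
    refine Finset.sum_congr rfl fun i hi => ?_
    rw [integral_indicator (hB i hi)]; simp
  have hEXsq : ∫ ω, X ω ^ 2 ∂μ = ∑ i ∈ s, ∑ j ∈ s, μ.real (B i ∩ B j) := by
    simp_rw [hXsq]
    rw [integral_finsetSum _ fun i hi => integrable_finsetSum _ fun j hj =>
      hint _ ((hB i hi).inter (hB j hj))]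
    refine Finset.sum_congr rfl fun i hi => ?_
    rw [integral_finsetSum _ fun j hj => hint _ ((hB i hi).inter (hB j hj))]
    refine Finset.sum_congr rfl fun j hj => ?_
    rw [integral_indicator ((hB i hi).inter (hB j hj))]; simp
  have hmeas : MeasurableSet {ω | ∀ i ∈ s, ω ∉ B i} := by
    have : {ω | ∀ i ∈ s, ω ∉ B i} = ⋂ i ∈ s, (B i)ᶜ := by ext; simp
    rw [this]
    exact Finset.measurableSet_biInter s fun i hi => (hB i hi).compl
  -- Chebyshev's argument: the integrand is `(X - M)^2`, which equals `M^2` wherever no event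
  -- occurs.
  have hdev : ∫ ω, (X ω ^ 2 - 2 * M * X ω + M ^ 2) ∂μ ≤ M + ε * M ^ 2 := by
    rw [integral_add (f := fun ω => X ω ^ 2 - 2 * M * X ω)
      (hXsqi.sub (hXi.const_mul _)) (integrable_const _), integral_sub hXsqi (hXi.const_mul _), integral_const_mul, hEX, hEXsq]
    simp only [integral_const, probReal_univ, one_smul]
    nlinarith
  have hlow : M ^ 2 * μ.real {ω | ∀ i ∈ s, ω ∉ B i}
      ≤ ∫ ω, (X ω ^ 2 - 2 * M * X ω + M ^ 2) ∂μ := by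
    have : M ^ 2 * μ.real {ω | ∀ i ∈ s, ω ∉ B i}
        = ∫ ω, {ω | ∀ i ∈ s, ω ∉ B i}.indicator (fun _ => M ^ 2) ω ∂μ := by
      rw [integral_indicator hmeas]; simp [mul_comm]
    rw [this]
    refine integral_mono ((integrable_const _).indicator hmeas)
      ((hXsqi.sub (hXi.const_mul _)).add (integrable_const _)) fun ω => ?_
    by_cases h : ω ∈ {ω | ∀ i ∈ s, ω ∉ B i}
    · have hX0 : X ω = 0 := Finset.sum_eq_zero fun i hi => by simp [h i hi]
      simp [Set.indicator_of_mem h, hX0]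
    · simp only [Set.indicator_of_notMem h]
      nlinarith [sq_nonneg (X ω - M)]
  have h := hlow.trans hdev
  have hM2 : (0 : ℝ) < M ^ 2 := by positivity
  rw [← mul_le_mul_iff_right₀ hM2]
  refine h.trans (le_of_eq ?_)
  field_simp

end SecondMoment

/-! ### Vertex cuts: isolating a vertex, and extracting a small side -/

section Connectivity

variable {V : Type*} [Fintype V]

theorem vertexConnectivity_le_card (G : SimpleGraph V) (S : Finset V)
    (h : ¬ (G.induce ((S : Set V)ᶜ)).Connected) : vertexConnectivity G ≤ S.card :=
  Nat.sInf_le ⟨S, rfl, Or.inl h⟩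

/-- Deleting all neighbours of a vertex isolates it. -/
theorem vertexConnectivity_le_of_neighbors (G : SimpleGraph V) (v : V) (N : Finset V)
    (hN : ∀ w, G.Adj v w ↔ w ∈ N) (hcard : N.card + 2 ≤ Fintype.card V) :
    vertexConnectivity G ≤ N.card := by
  classical
  have hv : v ∉ N := fun h => G.irrefl ((hN v).2 h)
  obtain ⟨u, hu⟩ : ∃ u, u ∉ insert v N := by
    by_contra! h
    have := Finset.card_insert_of_notMem hv
    rw [Finset.eq_univ_of_forall h, Finset.card_univ] at this
    omega
  rw [Finset.mem_insert, not_or] at hu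
  refine vertexConnectivity_le_card G N fun hc => ?_
  obtain ⟨w⟩ := hc.preconnected ⟨v, by simpa using hv⟩ ⟨u, by simpa using hu.2⟩
  cases w with
  | nil => exact hu.1 rfl
  | @cons _ x _ h _ =>
    have := (hN x).1 (by simpa using h)
    exact x.2 (by simpa using this)

/-- A small vertex cut yields a small set `A` whose outer neighbourhood is a small set `S`. -/
theorem exists_small_separation (G : SimpleGraph V) {k : ℕ} (hk : vertexConnectivity G < k)
    (hcard : k + 1 ≤ Fintype.card V) :
    ∃ A S : Finset V, A.Nonempty ∧ Disjoint A S ∧ S.card < k ∧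
      2 * A.card + S.card ≤ Fintype.card V ∧ (∀ v ∈ S, ∃ a ∈ A, G.Adj a v) ∧
      ∀ a ∈ A, ∀ v, v ∉ A → v ∉ S → ¬ G.Adj a v := by
  classical
  have hne : {m : ℕ | ∃ S : Finset V, S.card = m ∧
      (¬ (G.induce ((S : Set V)ᶜ)).Connected ∨ ((S : Set V)ᶜ).Subsingleton)}.Nonempty :=
    ⟨_, Finset.univ, rfl, Or.inr (by simp)⟩
  obtain ⟨T, hTcard, hT⟩ := Nat.sInf_mem hne
  change T.card = vertexConnectivity G at hTcard
  have hTc : Tᶜ.card + T.card = Fintype.card V := by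
    rw [Finset.card_compl]
    have := T.card_le_univ
    omega
  -- Since `|T| < k` and `k + 1 ≤ |V|`, at least two vertices survive, so `T` must disconnect the
  -- graph.
  have hns : ¬ ((T : Set V)ᶜ).Subsingleton := by
    intro h
    have : Tᶜ.card ≤ 1 := Finset.card_le_one.2 fun a ha b hb =>
      h (by simpa using ha) (by simpa using hb)
    omega
  have hdis := hT.resolve_right hns
  have hnpre : ¬ (G.induce ((T : Set V)ᶜ)).Preconnected := by
    intro hp
    obtain ⟨x, hx⟩ : Tᶜ.Nonempty := Finset.card_pos.1 (by omega)
    exact hdis ((SimpleGraph.connected_iff _).2 ⟨hp, ⟨⟨x, by simpa using hx⟩⟩⟩)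
  simp only [SimpleGraph.Preconnected, not_forall] at hnpre
  obtain ⟨x, y, hxy⟩ := hnpre
  -- `C` is the component of `x` in `G - T` and `D` the rest; the smaller one becomes `A`.
  set C : Finset V := Finset.univ.filter fun v => ∃ h : v ∈ (T : Set V)ᶜ,
    (G.induce ((T : Set V)ᶜ)).Reachable x ⟨v, h⟩ with hC
  set D : Finset V := Tᶜ \ C with hD
  have hCT : C ⊆ Tᶜ := fun v hv => by
    obtain ⟨h, -⟩ := (Finset.mem_filter.1 hv).2
    simpa using h
  have hxC : (x : V) ∈ C := by 
    have := x.2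
    simp only [Set.mem_compl_iff, Finset.mem_coe] at this
    simp [hC, this]
  have hyD : (y : V) ∈ D := by
    have := y.2
    simp only [Set.mem_compl_iff, Finset.mem_coe] at this
    simp [hD, hC, hxy, this]
  have hCD : ∀ c ∈ C, ∀ d ∈ D, ¬ G.Adj c d := by
    intro c hc d hd hadj
    rw [hD, Finset.mem_sdiff, Finset.mem_compl] at hd
    obtain ⟨h, hr⟩ := (Finset.mem_filter.1 hc).2
    refine hd.2 (Finset.mem_filter.2 ⟨Finset.mem_univ _, by simpa using hd.1, ?_⟩)
    exact hr.trans (SimpleGraph.Adj.reachable (by simpa using hadj))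
  have hcd : C.card + D.card + T.card = Fintype.card V := by
    have := Finset.card_sdiff_add_card_eq_card hCT
    rw [← hD] at this; omega
  -- Vertices of `T` without a neighbour in `A` are dropped. Each remaining vertex then forces an
  -- edge to `A`, which supplies the factor `(a p)^s` in the union bound.
  have key : ∀ A B : Finset V, A.Nonempty → Disjoint A T → (∀ v, v ∉ A → v ∉ T → v ∈ B) →
      (∀ a ∈ A, ∀ b ∈ B, ¬ G.Adj a b) → 2 * A.card + T.card ≤ Fintype.card V →
      ∃ A S : Finset V, A.Nonempty ∧ Disjoint A S ∧ S.card < k ∧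
      2 * A.card + S.card ≤ Fintype.card V ∧ (∀ v ∈ S, ∃ a ∈ A, G.Adj a v) ∧
      ∀ a ∈ A, ∀ v, v ∉ A → v ∉ S → ¬ G.Adj a v := by
    intro A B hA hAT hB hAB hle
    have hsub : (T.filter fun v => ∃ a ∈ A, G.Adj a v) ⊆ T := Finset.filter_subset _ _
    have hcl := Finset.card_le_card hsub
    refine ⟨A, T.filter fun v => ∃ a ∈ A, G.Adj a v, hA, hAT.mono_right hsub, by omega, by omega,
      fun v hv => (Finset.mem_filter.1 hv).2, fun a ha v hvA hvS hadj => ?_⟩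
    by_cases hvT : v ∈ T
    · exact hvS (Finset.mem_filter.2 ⟨hvT, a, ha, hadj⟩)
    · exact hAB a ha v (hB v hvA hvT) hadj
  have hCdisj : Disjoint C T := Finset.disjoint_left.2 fun v hv => by simpa using hCT hv
  rcases le_total C.card D.card with h | h
  · exact key C D ⟨x, hxC⟩ hCdisj (fun v h1 h2 => by simp [hD, h1, h2]) hCD (by omega)
  · refine key D C ⟨y, hyD⟩ (Finset.disjoint_left.2 fun v hv => ?_) (fun v h1 h2 => ?_)
      (fun a ha b hb hadj => hCD b hb a ha hadj.symm) (by omega)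
    · simp only [hD, Finset.mem_sdiff, Finset.mem_compl] at hv; exact hv.1
    · simp only [hD, Finset.mem_sdiff, Finset.mem_compl] at h1; tauto

end Connectivity

/-! ### Union bound over separations -/

section FirstMoment

open MeasureTheory unitInterval

variable {V : Type*}

/-- The event that every vertex of `S` has a neighbour in `A` and that no edge leaves `A ∪ S`
from `A`. -/
def separationEvent (A S : Finset V) : Set (SimpleGraph V) :=
  {G | (∀ v ∈ S, ∃ a ∈ A, G.Adj a v) ∧ ∀ a ∈ A, ∀ v, v ∉ A → v ∉ S → ¬ G.Adj a v}

/-- Choosing a neighbour in `A` for each vertex of `S` covers the event by `|A|^|S|` edge patterns,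
all with the same numbers of present and absent edges. -/
theorem measureReal_separationEvent_le [Fintype V] (p : I) {A S : Finset V} (hAS : Disjoint A S) :
    (SimpleGraph.binomialRandom V p).real (separationEvent A S) ≤
      (A.card * p : ℝ) ^ S.card * (1 - p) ^ (A.card * (Fintype.card V - S.card - A.card)) := by
  classical
  set E : (S → A) → Finset (Sym2 V) := fun f => S.attach.image fun v => s((f v : V), (v : V))
    with hEdef
  set F : Finset (Sym2 V) := (A ×ˢ (A ∪ S)ᶜ).image fun x => s(x.1, x.2) with hFdef
  have hsub : separationEvent A S ⊆ ⋃ f ∈ (Finset.univ : Finset (S → A)), edgePattern (E f) F := by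
    rintro G ⟨h1, h2⟩
    choose f hfA hf using h1
    simp only [Set.mem_iUnion, Finset.mem_univ, exists_true_left]
    refine ⟨fun v => ⟨f v v.2, hfA v v.2⟩, fun e he => ?_, fun e he => ?_⟩
    · obtain ⟨v, -, rfl⟩ := Finset.mem_image.1 he
      exact hf v v.2
    · obtain ⟨⟨a, b⟩, hab, rfl⟩ := Finset.mem_image.1 he
      simp only [Finset.mem_product, Finset.mem_compl, Finset.mem_union, not_or] at hab
      exact h2 a hab.1 b hab.2.1 hab.2.2
  have hEcard : ∀ f, (E f).card = S.card := by
    intro f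
    rw [hEdef, Finset.card_image_of_injective, Finset.card_attach]
    intro v w hvw
    rcases Sym2.eq_iff.1 hvw with ⟨-, h⟩ | ⟨h, -⟩
    · exact Subtype.ext h
    · exact absurd (h ▸ (f v).2) (Finset.disjoint_right.1 hAS w.2)
  have hFcard : F.card = A.card * (Fintype.card V - S.card - A.card) := by
    rw [hFdef, Finset.card_image_of_injOn, Finset.card_product, Finset.card_compl,
      Finset.card_union_of_disjoint hAS, Nat.sub_sub, add_comm]
    rintro ⟨a, b⟩ hab ⟨c, d⟩ hcd h
    simp only [Finset.coe_product, Set.mem_prod, Finset.mem_coe, Finset.mem_compl,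
      Finset.mem_union, not_or] at hab hcd
    rcases Sym2.eq_iff.1 h with ⟨h1, h2⟩ | ⟨h1, h2⟩
    · exact Prod.ext h1 h2
    · change a = d at h1
      exact absurd (h1 ▸ hab.1) hcd.2.1
  have hprob : ∀ f, (SimpleGraph.binomialRandom V p).real (edgePattern (E f) F) =
      (p : ℝ) ^ S.card * (1 - p) ^ (A.card * (Fintype.card V - S.card - A.card)) := by
    intro f
    rw [binomialRandom_real_edgePattern, hEcard, hFcard]
    · rw [Finset.disjoint_left]
      intro e he heF
      obtain ⟨v, -, rfl⟩ := Finset.mem_image.1 he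
      obtain ⟨⟨a, b⟩, hab, h⟩ := Finset.mem_image.1 heF
      simp only [Finset.mem_product, Finset.mem_compl, Finset.mem_union, not_or] at hab
      rcases Sym2.eq_iff.1 h with ⟨-, h2⟩ | ⟨-, h2⟩
      · change b = v at h2
        exact hab.2.2 (h2 ▸ v.2)
      · change b = f v at h2
        exact hab.2.1 (h2 ▸ (f v).2)
    · intro e he
      obtain ⟨v, -, rfl⟩ := Finset.mem_image.1 he
      rw [Sym2.mk_isDiag_iff]
      intro h
      exact Finset.disjoint_right.1 hAS v.2 (h ▸ (f v).2)
    · intro e he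
      obtain ⟨⟨a, b⟩, hab, rfl⟩ := Finset.mem_image.1 he
      simp only [Finset.mem_product, Finset.mem_compl, Finset.mem_union, not_or] at hab
      rw [Sym2.mk_isDiag_iff]
      intro h
      change a = b at h
      exact hab.2.1 (h ▸ hab.1)
  refine (measureReal_mono hsub (measure_ne_top _ _)).trans ((measureReal_biUnion_finset_le _ _).trans (le_of_eq ?_))
  simp only [hprob, Finset.sum_const, Finset.card_univ, Fintype.card_fun, Fintype.card_coe,
    nsmul_eq_mul, Nat.cast_pow]
  ring

/-- Union bound over the pairs from `exists_small_separation`, grouped by size; disjointness of `A`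
and `S` is dropped when counting. -/
theorem measureReal_vertexConnectivity_lt_le [Fintype V] (p : I) (k : ℕ)
    (hk : k + 1 ≤ Fintype.card V) :
    (SimpleGraph.binomialRandom V p).real {G | vertexConnectivity G < k} ≤
      ∑ s ∈ Finset.range k,
        ∑ a ∈ (Finset.Icc 1 (Fintype.card V)).filter fun a => 2 * a + s ≤ Fintype.card V,
          ((Fintype.card V).choose a : ℝ) * ((Fintype.card V).choose s *
            ((a * p : ℝ) ^ s * (1 - p) ^ (a * (Fintype.card V - s - a)))) := by
  classical
  have hp := p.2.1
  have hp1 : (0 : ℝ) ≤ 1 - p := sub_nonneg.2 p.2.2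
  have hsub : {G : SimpleGraph V | vertexConnectivity G < k} ⊆
      ⋃ s ∈ Finset.range k,
        ⋃ a ∈ (Finset.Icc 1 (Fintype.card V)).filter fun a => 2 * a + s ≤ Fintype.card V,
          ⋃ A ∈ Finset.powersetCard a (Finset.univ : Finset V),
            ⋃ S ∈ (Finset.powersetCard s (Finset.univ : Finset V)).filter fun S => Disjoint A S,
              separationEvent A S := by
    intro G hG
    obtain ⟨A, S, hA, hAS, hSk, hcard, h1, h2⟩ := exists_small_separation G hG hk
    simp only [Set.mem_iUnion]
    refine ⟨S.card, Finset.mem_range.2 hSk, A.card, ?_, A, ?_, S, ?_, h1, h2⟩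
    · rw [Finset.mem_filter, Finset.mem_Icc]
      exact ⟨⟨hA.card_pos, A.card_le_univ⟩, hcard⟩
    · simp
    · simp [hAS]
  refine (measureReal_mono hsub (measure_ne_top _ _)).trans ((measureReal_biUnion_finset_le _ _).trans ?_)
  refine Finset.sum_le_sum fun s _ => (measureReal_biUnion_finset_le _ _).trans ?_
  refine Finset.sum_le_sum fun a _ => (measureReal_biUnion_finset_le _ _).trans ?_
  have hA : ∀ A ∈ Finset.powersetCard a (Finset.univ : Finset V),
      (SimpleGraph.binomialRandom V p).real
        (⋃ S ∈ (Finset.powersetCard s (Finset.univ : Finset V)).filter fun S => Disjoint A S,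
          separationEvent A S) ≤ (Fintype.card V).choose s *
            ((a * p : ℝ) ^ s * (1 - p) ^ (a * (Fintype.card V - s - a))) := by
    intro A hA
    have hAc := (Finset.mem_powersetCard.1 hA).2
    refine (measureReal_biUnion_finset_le _ _).trans ?_
    refine (Finset.sum_le_card_nsmul _ _
      ((a * p : ℝ) ^ s * (1 - p) ^ (a * (Fintype.card V - s - a))) fun S hS => ?_).trans ?_
    · obtain ⟨hS, hd⟩ := Finset.mem_filter.1 hS
      have := measureReal_separationEvent_le p hd
      rwa [hAc, (Finset.mem_powersetCard.1 hS).2] at this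
    · rw [nsmul_eq_mul]
      gcongr
      refine (Finset.card_filter_le _ _).trans ?_
      rw [Finset.card_powersetCard, Finset.card_univ]
  refine (Finset.sum_le_card_nsmul _ _ _ hA).trans (le_of_eq ?_)
  rw [nsmul_eq_mul, Finset.card_powersetCard, Finset.card_univ]

end FirstMoment

/-! ### Prescribed neighbourhoods and their correlations -/

section Neighborhoods

open MeasureTheory unitInterval

variable {V : Type*}

theorem edgePattern_inter [DecidableEq V] (E F E' F' : Finset (Sym2 V)) :
    edgePattern E F ∩ edgePattern E' F' = edgePattern (E ∪ E') (F ∪ F') := by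
  ext G
  simp only [edgePattern, Set.mem_inter_iff, Set.mem_ofPred_eq, Finset.mem_union, or_imp,
    forall_and]
  tauto

/-- The star from `v` to the vertices of `N`. -/
def starEdges [DecidableEq V] (v : V) (N : Finset V) : Finset (Sym2 V) := N.image fun w => s(v, w)

theorem card_starEdges [DecidableEq V] (v : V) (N : Finset V) :
    (starEdges v N).card = N.card :=
  Finset.card_image_of_injective _ fun _ _ h => Sym2.congr_right.1 h

theorem mem_starEdges [DecidableEq V] {v : V} {N : Finset V} {e : Sym2 V} :
    e ∈ starEdges v N ↔ ∃ w ∈ N, s(v, w) = e := Finset.mem_image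

theorem not_isDiag_of_mem_starEdges [DecidableEq V] {v : V} {N : Finset V} (hv : v ∉ N)
    {e : Sym2 V} (he : e ∈ starEdges v N) : ¬ e.IsDiag := by
  obtain ⟨w, hw, rfl⟩ := mem_starEdges.1 he
  rw [Sym2.mk_isDiag_iff]
  rintro rfl
  exact hv hw

theorem disjoint_starEdges [DecidableEq V] {v : V} {N N' : Finset V} (h : Disjoint N N') :
    Disjoint (starEdges v N) (starEdges v N') := by
  rw [Finset.disjoint_left]
  intro e he he'
  obtain ⟨w, hw, rfl⟩ := mem_starEdges.1 he
  obtain ⟨w', hw', h'⟩ := mem_starEdges.1 he'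
  rw [Sym2.congr_right.1 h'] at hw'
  exact Finset.disjoint_left.1 h hw hw'

/-- The event that `N` is the neighbourhood of `v`. -/
def neighborhoodEvent (v : V) (N : Finset V) : Set (SimpleGraph V) :=
  {G | ∀ w, G.Adj v w ↔ w ∈ N}

variable [Fintype V] [DecidableEq V]

theorem neighborhoodEvent_eq {v : V} {N : Finset V} :
    neighborhoodEvent v N = edgePattern (starEdges v N) (starEdges v (insert v N)ᶜ) := by
  ext G
  constructor
  · refine fun h => ⟨fun e he => ?_, fun e he hadj => ?_⟩
    · obtain ⟨w, hw, rfl⟩ := mem_starEdges.1 he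
      exact (h w).2 hw
    · obtain ⟨w, hw, rfl⟩ := mem_starEdges.1 he
      simp only [Finset.mem_compl, Finset.mem_insert, not_or] at hw
      exact hw.2 ((h w).1 hadj)
  · refine fun h w => ⟨fun hadj => ?_, fun hw => h.1 _ (mem_starEdges.2 ⟨w, hw, rfl⟩)⟩
    by_contra hw
    refine h.2 _ (mem_starEdges.2 ⟨w, ?_, rfl⟩) hadj
    simp only [Finset.mem_compl, Finset.mem_insert, not_or]
    exact ⟨fun he => G.irrefl (he ▸ hadj), hw⟩

theorem card_starEdges_compl_insert {v : V} {N : Finset V} (hv : v ∉ N) :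
    (starEdges v (insert v N)ᶜ).card = Fintype.card V - 1 - N.card := by
  rw [card_starEdges, Finset.card_compl, Finset.card_insert_of_notMem hv]
  omega

theorem measureReal_neighborhoodEvent (p : I) {v : V} {N : Finset V} (hv : v ∉ N) :
    (SimpleGraph.binomialRandom V p).real (neighborhoodEvent v N) =
      (p : ℝ) ^ N.card * (1 - p) ^ (Fintype.card V - 1 - N.card) := by
  rw [neighborhoodEvent_eq, binomialRandom_real_edgePattern, card_starEdges,
    card_starEdges_compl_insert hv]
  · exact disjoint_starEdges (Finset.disjoint_right.2 fun w hw h => by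
      simp only [Finset.mem_compl, Finset.mem_insert, not_or] at hw
      exact hw.2 h)
  · exact fun e => not_isDiag_of_mem_starEdges hv
  · exact fun e => not_isDiag_of_mem_starEdges (by simp)

/-- Neither centre lies in either neighbourhood, so the only edge both events can constrain is `s(v,
v')`, which both want absent. The division by `1 - p` corrects for counting it twice. -/
theorem measureReal_neighborhoodEvent_inter_le (p : I) (hp : (p : ℝ) < 1) {v v' : V}
    {N N' : Finset V} (hvv' : v ≠ v') (hvN : v ∉ N) (hvN' : v ∉ N') (hv'N : v' ∉ N)
    (hv'N' : v' ∉ N') :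
    (SimpleGraph.binomialRandom V p).real (neighborhoodEvent v N ∩ neighborhoodEvent v' N') ≤
      ((p : ℝ) ^ N.card * (1 - p) ^ (Fintype.card V - 1 - N.card)) *
        ((p : ℝ) ^ N'.card * (1 - p) ^ (Fintype.card V - 1 - N'.card)) / (1 - p) := by
  have hp1 : (0 : ℝ) < 1 - p := sub_pos.2 hp
  have hcross : ∀ {u u' : V} {A B : Finset V}, u ≠ u' → u' ∉ A →
      Disjoint (starEdges u A) (starEdges u' B) := by
    intro u u' A B hne hA
    rw [Finset.disjoint_left]
    intro e he he'
    obtain ⟨w, hw, rfl⟩ := mem_starEdges.1 he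
    obtain ⟨w', hw', h'⟩ := mem_starEdges.1 he'
    rcases Sym2.eq_iff.1 h' with ⟨h1, -⟩ | ⟨h1, -⟩
    · exact hne h1.symm
    · exact hA (h1 ▸ hw)
  have hself : ∀ {u : V} {A : Finset V},
      Disjoint (starEdges u A) (starEdges u (insert u A)ᶜ) := fun {u A} =>
    disjoint_starEdges (Finset.disjoint_right.2 fun w hw h => by
      simp only [Finset.mem_compl, Finset.mem_insert, not_or] at hw
      exact hw.2 h)
  have hint : (starEdges v (insert v N)ᶜ ∩ starEdges v' (insert v' N')ᶜ).card ≤ 1 := by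
    refine (Finset.card_le_card (t := {s(v, v')}) fun e he => ?_).trans (by simp)
    rw [Finset.mem_inter] at he
    obtain ⟨w, hw, rfl⟩ := mem_starEdges.1 he.1
    obtain ⟨w', hw', h'⟩ := mem_starEdges.1 he.2
    rcases Sym2.eq_iff.1 h' with ⟨h1, -⟩ | ⟨h1, -⟩
    · exact absurd h1.symm hvv'
    · rw [h1, Finset.mem_singleton]
  rw [neighborhoodEvent_eq, neighborhoodEvent_eq, edgePattern_inter,
    binomialRandom_real_edgePattern,
    Finset.card_union_of_disjoint (hcross hvv' hv'N), card_starEdges, card_starEdges, le_div_iff₀ hp1]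
  · have hc := Finset.card_union_add_card_inter (starEdges v (insert v N)ᶜ)
      (starEdges v' (insert v' N')ᶜ)
    rw [card_starEdges_compl_insert hvN, card_starEdges_compl_insert hv'N'] at hc
    have : (1 - p : ℝ) ^ ((starEdges v (insert v N)ᶜ ∪ starEdges v' (insert v' N')ᶜ).card + 1) ≤
        (1 - p) ^ ((Fintype.card V - 1 - N.card) + (Fintype.card V - 1 - N'.card)) :=
      pow_le_pow_of_le_one hp1.le (by linarith [p.2.1]) (by omega)
    calc _ = (p : ℝ) ^ (N.card + N'.card) * (1 - p : ℝ) ^ ((starEdges v (insert v N)ᶜ ∪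
              starEdges v' (insert v' N')ᶜ).card + 1) := by ring
      _ ≤ _ := mul_le_mul_of_nonneg_left this (pow_nonneg p.2.1 _)
      _ = _ := by ring
  · rw [Finset.disjoint_union_left, Finset.disjoint_union_right, Finset.disjoint_union_right]
    exact ⟨⟨hself, hcross hvv' hv'N⟩, hcross hvv'.symm hvN', hself⟩
  · intro e he
    rcases Finset.mem_union.1 he with h | h
    exacts [not_isDiag_of_mem_starEdges hvN h, not_isDiag_of_mem_starEdges hv'N' h]
  · intro e he
    rcases Finset.mem_union.1 he with h | h
    exacts [not_isDiag_of_mem_starEdges (by simp) h, not_isDiag_of_mem_starEdges (by simp) h]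

/-- If the expected number `M` of vertices in `U` with exactly `d` neighbours, all of them in `W`,
is large, then the vertex connectivity is at most `d` with high probability. -/
theorem measureReal_lt_vertexConnectivity_le (p : I) (hp : (p : ℝ) < 1) {U W : Finset V}
    (hUW : Disjoint U W) {d : ℕ} (hd : d + 2 ≤ Fintype.card V) {M : ℝ} (hM : 0 < M)
    (hMeq : M = U.card * W.card.choose d * (p ^ d * (1 - p) ^ (Fintype.card V - 1 - d))) :
    (SimpleGraph.binomialRandom V p).real {G | d < vertexConnectivity G} ≤
      1 / M + p / (1 - p) := by
  have hp1 : (0 : ℝ) < 1 - p := sub_pos.2 hp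
  set q : ℝ := p ^ d * (1 - p) ^ (Fintype.card V - 1 - d) with hq
  have hq0 : 0 ≤ q := mul_nonneg (pow_nonneg p.2.1 _) (pow_nonneg hp1.le _)
  -- Taking centres in `U` and neighbourhoods in the disjoint `W` ensures that no centre lies in
  -- another's neighbourhood.
  set J : Finset (V × Finset V) := U ×ˢ Finset.powersetCard d W with hJ
  have hmem : ∀ x ∈ J, x.1 ∈ U ∧ x.2 ⊆ W ∧ x.2.card = d := by
    intro x hx
    rwa [hJ, Finset.mem_product, Finset.mem_powersetCard] at hx
  have hnot : ∀ x ∈ J, ∀ y ∈ J, x.1 ∉ y.2 := fun x hx y hy h =>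
    Finset.disjoint_left.1 hUW (hmem x hx).1 ((hmem y hy).2.1 h)
  have hprob : ∀ x ∈ J,
      (SimpleGraph.binomialRandom V p).real (neighborhoodEvent x.1 x.2) = q := by
    intro x hx
    rw [measureReal_neighborhoodEvent p (hnot x hx x hx), (hmem x hx).2.2]
  have hJcard : (J.card : ℝ) * q = M := by
    rw [hMeq, hJ, Finset.card_product, Finset.card_powersetCard, Nat.cast_mul]
  have hpair : ∀ x ∈ J, ∀ y ∈ J, (SimpleGraph.binomialRandom V p).real
      (neighborhoodEvent x.1 x.2 ∩ neighborhoodEvent y.1 y.2) ≤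
        (if x = y then q else 0) + q * q / (1 - p) := by
    intro x hx y hy
    have hnn : 0 ≤ q * q / (1 - p) := by positivity
    by_cases hxy : x.1 = y.1
    · by_cases h2 : x = y
      · rw [h2, Set.inter_self, hprob y hy, if_pos rfl]
        linarith
      -- A vertex has only one neighbourhood, so distinct pairs with the same centre are
      -- incompatible.
      · have : neighborhoodEvent x.1 x.2 ∩ neighborhoodEvent y.1 y.2 = ∅ := by
          rw [Set.eq_empty_iff_forall_notMem]
          rintro G ⟨h1, h3⟩
          refine h2 (Prod.ext hxy (Finset.ext fun w => ?_))
          rw [← h1 w, ← h3 w, hxy]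
        rw [this, measureReal_empty, if_neg h2]
        linarith
    · rw [if_neg fun h => hxy (by rw [h]), zero_add]
      have := measureReal_neighborhoodEvent_inter_le p hp hxy (hnot x hx x hx) (hnot x hx y hy)
        (hnot y hy x hx) (hnot y hy y hy)
      rwa [(hmem x hx).2.2, (hmem y hy).2.2] at this
  have hsub : {G : SimpleGraph V | d < vertexConnectivity G} ⊆
      {G | ∀ x ∈ J, G ∉ neighborhoodEvent x.1 x.2} := by
    intro G hG x hx hGx
    have := vertexConnectivity_le_of_neighbors G x.1 x.2 hGx (by rw [(hmem x hx).2.2]; exact hd)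
    rw [(hmem x hx).2.2] at this
    exact absurd hG (not_lt.2 this)
  refine (measureReal_mono hsub).trans (measureReal_forall_notMem_le _ J
    (fun x => neighborhoodEvent x.1 x.2) (fun _ _ => measurableSet_simpleGraph _) hM ?_ ?_)
  · rw [Finset.sum_congr rfl hprob, Finset.sum_const, nsmul_eq_mul, hJcard]
  · refine (Finset.sum_le_sum fun x hx => Finset.sum_le_sum fun y hy => hpair x hx y hy).trans
      (le_of_eq ?_)
    simp only [Finset.sum_add_distrib, Finset.sum_const, nsmul_eq_mul, Finset.sum_ite_eq]
    rw [Finset.sum_congr rfl fun x hx => if_pos hx, Finset.sum_const, nsmul_eq_mul, hJcard]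
    -- The correlation sum is at most `M + M^2 / (1 - p)`, and `1 / (1 - p) = 1 + p / (1 - p)`;
    -- hence the `ε` of the second moment bound.
    have : (J.card : ℝ) * (J.card * (q * q / (1 - p))) = M ^ 2 / (1 - p) := by
      rw [← hJcard]; ring
    rw [this]
    field_simp
    ring

end Neighborhoods

/-! ### Size of the edge probability -/

section Asymptotics

theorem tendsto_log_natCast_atTop : Tendsto (fun n : ℕ => Real.log n) atTop atTop :=
  Real.tendsto_log_atTop.comp tendsto_natCast_atTop_atTop

theorem tendsto_loglog_natCast_atTop : Tendsto (fun n : ℕ => Real.log (Real.log n)) atTop atTop :=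
  Real.tendsto_log_atTop.comp tendsto_log_natCast_atTop

theorem tendsto_log_pow_div_natCast (m : ℕ) :
    Tendsto (fun n : ℕ => Real.log n ^ m / n) atTop (𝓝 0) :=
  ((Real.isLittleO_pow_log_id_atTop (n := m)).tendsto_div_nhds_zero).comp tendsto_natCast_atTop_atTop

/-- Later estimates use the definition of the density only through these properties of `x`. The
bounds hold because eventually `0 ≤ log log log n ≤ log log n` and `(k+1) log log n ≤ log n`. -/
theorem eventually_edgeDensity_eq (k : ℕ) : ∀ᶠ n : ℕ in atTop, ∃ x : ℝ,
    edgeDensity k n = x / n ∧ Real.log n ≤ x ∧ x ≤ 2 * Real.log n ∧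
      Real.exp (-x) = Real.log (Real.log n) / (n * Real.log n ^ (k + 1)) := by
  have hsmall : ∀ᶠ n : ℕ in atTop, (k + 1 : ℝ) * Real.log (Real.log n) ≤ Real.log n := by
    have h : ∀ᶠ y : ℝ in atTop, (k + 1 : ℝ) * Real.log y ≤ y := by
      have := (Real.isLittleO_log_id_atTop.const_mul_left (k + 1 : ℝ)).bound one_pos
      filter_upwards [this, eventually_ge_atTop 0] with y hy hy0
      rw [one_mul, id, Real.norm_of_nonneg hy0] at hy
      exact (Real.le_norm_self _).trans hy
    exact tendsto_log_natCast_atTop.eventually h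
  filter_upwards [hsmall, tendsto_log_natCast_atTop.eventually_ge_atTop 1,
    tendsto_loglog_natCast_atTop.eventually_ge_atTop 1, eventually_ge_atTop 1] with n h1 h2 h3 hn
  have hn0 : (0 : ℝ) < n := by exact_mod_cast hn
  have hL : 0 < Real.log n := by linarith
  have hLL : 0 < Real.log (Real.log n) := by linarith
  have h4 : Real.log (Real.log (Real.log n)) ≤ Real.log (Real.log n) :=
    Real.log_le_self hLL.le
  have h5 : 0 ≤ Real.log (Real.log (Real.log n)) := Real.log_nonneg h3
  refine ⟨_, rfl, ?_, by linarith, ?_⟩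
  · have : 0 ≤ (k : ℝ) * Real.log (Real.log n) := by positivity
    linarith
  · have hexp : -(Real.log n + (k + 1) * Real.log (Real.log n)
        - Real.log (Real.log (Real.log n))) = Real.log (Real.log (Real.log n))
        - (Real.log n + ((k + 1 : ℕ) : ℝ) * Real.log (Real.log n)) := by push_cast; ring
    rw [hexp, Real.exp_sub, Real.exp_add, Real.exp_log hLL, Real.exp_log hn0, Real.exp_nat_mul,
      Real.exp_log hL]

theorem eventually_coe_edgeProb (k : ℕ) :
    ∀ᶠ n : ℕ in atTop, (edgeProb k n : ℝ) = edgeDensity k n := by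
  have h0 : ∀ᶠ n : ℕ in atTop, Real.log n ^ 1 / n < 1 / 2 :=
    (tendsto_log_pow_div_natCast 1).eventually_lt_const (by norm_num)
  filter_upwards [eventually_edgeDensity_eq k, h0,
    tendsto_log_natCast_atTop.eventually_ge_atTop 1, eventually_ge_atTop 1] with n hx h0 hL hn
  obtain ⟨x, hx, h1, h2, -⟩ := hx
  have hn0 : (0 : ℝ) < n := by exact_mod_cast hn
  have hmem : edgeDensity k n ∈ Set.Icc (0 : ℝ) 1 := by
    rw [hx]
    refine ⟨div_nonneg (by linarith) hn0.le, ?_⟩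
    rw [pow_one, div_lt_iff₀ hn0] at h0
    rw [div_le_one hn0]
    linarith
  rw [edgeProb, Set.projIcc_of_mem _ hmem]

theorem tendsto_coe_edgeProb (k : ℕ) :
    Tendsto (fun n : ℕ => (edgeProb k n : ℝ)) atTop (𝓝 0) := by
  have h := (tendsto_log_pow_div_natCast 1).const_mul 2
  rw [mul_zero] at h
  refine squeeze_zero' (Eventually.of_forall fun n => (edgeProb k n).2.1) ?_ h
  filter_upwards [eventually_edgeDensity_eq k, eventually_coe_edgeProb k, eventually_ge_atTop 1]
    with n hx hp hn
  obtain ⟨x, hx, -, h2, -⟩ := hx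
  rw [hp, hx, pow_one, mul_div_assoc']
  gcongr

end Asymptotics

/-! ### Separations are unlikely -/

section Separations

theorem choose_mul_pow_le {n s a : ℕ} {x : ℝ} (hn : 0 < n) (hx : 0 ≤ x) :
    (n.choose s : ℝ) * (a * (x / n)) ^ s ≤ (a * x) ^ s := by
  have h : (n.choose s : ℝ) ≤ (n : ℝ) ^ s := by exact_mod_cast Nat.choose_le_pow n s
  have hn0 : (0 : ℝ) < n := by exact_mod_cast hn
  calc (n.choose s : ℝ) * (a * (x / n)) ^ s ≤ (n : ℝ) ^ s * (a * (x / n)) ^ s := by gcongr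
    _ = (a * x) ^ s := by rw [← mul_pow]; congr 1; field_simp

theorem one_sub_pow_mul_le {n s a : ℕ} {p : ℝ} (hp1 : p ≤ 1) (h : 2 * a + s ≤ n) :
    (1 - p) ^ (a * (n - s - a)) ≤ Real.exp (-(p * (a * (n - s - a)))) := by
  have h1 : ((a * (n - s - a) : ℕ) : ℝ) = a * (n - s - a) := by
    rw [Nat.cast_mul, Nat.cast_sub (by omega), Nat.cast_sub (by omega)]
  calc (1 - p) ^ (a * (n - s - a)) ≤ Real.exp (-p) ^ (a * (n - s - a)) :=
        pow_le_pow_left₀ (by linarith) (Real.one_sub_le_exp_neg p) _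
    _ = _ := by rw [← Real.exp_nat_mul, h1]; congr 1; ring

/-- Bound for the expected number of separations with a small side. -/
theorem separation_term_le_of_small {k n s a : ℕ} {x : ℝ} (hs : s < k) (hn : 0 < n)
    (ha : 1 ≤ a) (h : 2 * a + s ≤ n) (hL : 1 ≤ Real.log n) (hx1 : Real.log n ≤ x)
    (hx2 : x ≤ 2 * Real.log n) (hxn : x / n ≤ 1) (hkL : Real.log n * k ≤ n)
    (hexp : Real.exp (-x) = Real.log (Real.log n) / (n * Real.log n ^ (k + 1)))
    (hsmall : a * Real.log n ≤ 6 * n) :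
    (n.choose a : ℝ) * (n.choose s *
      ((a * (x / n)) ^ s * (1 - x / n) ^ (a * (n - s - a)))) ≤
      k.factorial * (2 * Real.log n) ^ (k - 1) *
        (Real.exp 15 * Real.log (Real.log n) / Real.log n ^ (k + 1)) ^ a := by
  have hn0 : (0 : ℝ) < n := by exact_mod_cast hn
  have ha1 : (1 : ℝ) ≤ a := by exact_mod_cast ha
  have hx0 : 0 < x := by linarith
  have hch : (n.choose a : ℝ) ≤ (n : ℝ) ^ a := by exact_mod_cast Nat.choose_le_pow n a
  have hS : (n.choose s : ℝ) * (a * (x / n)) ^ s ≤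
      k.factorial * Real.exp 1 ^ a * (2 * Real.log n) ^ (k - 1) := by
    refine (choose_mul_pow_le hn hx0.le).trans ?_
    rw [mul_pow]
    -- From `a^k / k! ≤ exp a`: the polynomial factor goes into the geometric base, raising the
    -- exponent 14 below to 15.
    have h1 : (a : ℝ) ^ s ≤ k.factorial * Real.exp 1 ^ a := by
      have h2 := Real.pow_div_factorial_le_exp (a : ℝ) (by positivity) k
      rw [div_le_iff₀ (by positivity)] at h2
      rw [← Real.exp_nat_mul, mul_one, mul_comm]
      exact (pow_le_pow_right₀ ha1 hs.le).trans h2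
    have h3 : x ^ s ≤ (2 * Real.log n) ^ (k - 1) :=
      (pow_le_pow_left₀ hx0.le hx2 s).trans
        (pow_le_pow_right₀ (by linarith) (by omega))
    gcongr
  have hE : (1 - x / n) ^ (a * (n - s - a)) ≤ (Real.exp (-x) * Real.exp 14) ^ a := by
    refine (one_sub_pow_mul_le hxn h).trans ?_
    rw [← Real.exp_add, ← Real.exp_nat_mul, Real.exp_le_exp]
    -- `x (s + a) ≤ 2 k log n + 2 a log n ≤ 2n + 12n`.
    have h1 : x / n * (s + a) ≤ 14 := by
      have hsk : (s : ℝ) ≤ k := by exact_mod_cast hs.le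
      rw [div_mul_eq_mul_div, div_le_iff₀ hn0]
      have : x * (s + a) ≤ 2 * Real.log n * (k + a) := by gcongr
      nlinarith
    have h2 : x / n * (a * (n - s - a)) = a * (x - x / n * (s + a)) := by field_simp; ring
    rw [h2]
    nlinarith
  have hp0 : 0 ≤ 1 - x / n := by linarith
  calc (n.choose a : ℝ) * (n.choose s *
      ((a * (x / n)) ^ s * (1 - x / n) ^ (a * (n - s - a))))
      = n.choose a * ((n.choose s * (a * (x / n)) ^ s) * (1 - x / n) ^ (a * (n - s - a))) := by
        ring
    _ ≤ (n : ℝ) ^ a * ((k.factorial * Real.exp 1 ^ a * (2 * Real.log n) ^ (k - 1)) *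
        (Real.exp (-x) * Real.exp 14) ^ a) := by gcongr
    _ = k.factorial * (2 * Real.log n) ^ (k - 1) *
        (n * (Real.exp 1 * (Real.exp (-x) * Real.exp 14))) ^ a := by
        rw [mul_pow, mul_pow]; ring
    _ = _ := by
        have h15 : Real.exp 15 = Real.exp 1 * Real.exp 14 := by
          rw [← Real.exp_add]; norm_num
        rw [hexp, h15]
        congr 2
        field_simp

/-- Bound for the expected number of separations with two large sides. -/
theorem separation_term_le_of_large {k n s a : ℕ} {x : ℝ} (hs : s < k) (hn : 0 < n)
    (h : 2 * a + s ≤ n) (hL : 1 ≤ Real.log n) (hx1 : Real.log n ≤ x) (hxn : x / n ≤ 1)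
    (hkn : 3 * k ≤ n) (hlarge : 6 * n ≤ a * Real.log n) :
    (n.choose a : ℝ) * (n.choose s *
      ((a * (x / n)) ^ s * (1 - x / n) ^ (a * (n - s - a)))) ≤
      (n : ℝ) ^ (2 * k) * Real.exp (-n) := by
  have hn0 : (0 : ℝ) < n := by exact_mod_cast hn
  have hn1 : (1 : ℝ) ≤ n := by exact_mod_cast hn
  have hx0 : 0 < x := by linarith
  have hp0 : 0 ≤ 1 - x / n := by linarith
  have han : (a : ℝ) ≤ n := by exact_mod_cast (by omega : a ≤ n)
  have hxn' : x ≤ n := by rwa [div_le_one hn0] at hxn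
  have hch : (n.choose a : ℝ) ≤ Real.exp n := by
    have h1 : (n.choose a : ℝ) ≤ 2 ^ n := by exact_mod_cast Nat.choose_le_two_pow n a
    have h2 : (2 : ℝ) ≤ Real.exp 1 := by linarith [Real.add_one_le_exp (1 : ℝ)]
    calc (n.choose a : ℝ) ≤ 2 ^ n := h1
      _ ≤ Real.exp 1 ^ n := by gcongr
      _ = Real.exp n := by rw [← Real.exp_nat_mul, mul_one]
  have hS : (n.choose s : ℝ) * (a * (x / n)) ^ s ≤ (n : ℝ) ^ (2 * k) := by
    calc _ ≤ (a * x) ^ s := choose_mul_pow_le hn hx0.le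
      _ ≤ ((n : ℝ) * n) ^ s := by gcongr
      _ = (n : ℝ) ^ (2 * s) := by rw [← sq, ← pow_mul]
      _ ≤ _ := pow_le_pow_right₀ hn1 (by omega)
  have hE : (1 - x / n) ^ (a * (n - s - a)) ≤ Real.exp (-(2 * n)) := by
    refine (one_sub_pow_mul_le hxn h).trans ?_
    rw [Real.exp_le_exp, neg_le_neg_iff]
    have hc1 : (2 * a + s : ℝ) ≤ n := by exact_mod_cast h
    have hc2 : (3 * s : ℝ) ≤ n := by exact_mod_cast (by omega : 3 * s ≤ n)
    -- From `2a + s ≤ n` and `3s ≤ n`. The threshold 6 then gives exponent `6n / 3 = 2n`, leaving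
    -- `exp (-n)` after the factor `exp n` for the choice of `A`.
    have hc3 : (n : ℝ) / 3 ≤ n - s - a := by linarith
    calc (2 * n : ℝ) ≤ a * Real.log n / 3 := by linarith
      _ ≤ a * x / 3 := by gcongr
      _ = x / n * (a * (n / 3)) := by field_simp
      _ ≤ _ := by gcongr
  calc (n.choose a : ℝ) * (n.choose s *
      ((a * (x / n)) ^ s * (1 - x / n) ^ (a * (n - s - a))))
      = n.choose a * ((n.choose s * (a * (x / n)) ^ s) * (1 - x / n) ^ (a * (n - s - a))) := by
        ring
    _ ≤ Real.exp n * ((n : ℝ) ^ (2 * k) * Real.exp (-(2 * n))) := by gcongr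
    _ = (n : ℝ) ^ (2 * k) * (Real.exp n * Real.exp (-(2 * n))) := by ring
    _ = _ := by rw [← Real.exp_add]; congr 2; ring

theorem sum_Icc_pow_le {r : ℝ} (h0 : 0 ≤ r) (h1 : r ≤ 1 / 2) (n : ℕ) :
    ∑ a ∈ Finset.Icc 1 n, r ^ a ≤ 2 * r := by
  -- The subtracted term strengthens the claim so that induction closes.
  have h : ∑ a ∈ Finset.Icc 1 n, r ^ a ≤ 2 * r - 2 * r ^ (n + 1) := by
    induction n with
    | zero => simp
    | succ n ih =>
      rw [Finset.sum_Icc_succ_top (by omega)]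
      have : r ^ (n + 2) ≤ r ^ (n + 1) * (1 / 2) := by
        rw [pow_succ r (n + 1)]; gcongr
      have e : n + 1 + 1 = n + 2 := rfl
      rw [e]
      linarith
  exact h.trans (by linarith [pow_nonneg h0 (n + 1)])

theorem tendsto_measureReal_vertexConnectivity_lt (k : ℕ) (hk : 1 ≤ k) :
    Tendsto (fun n : ℕ => (SimpleGraph.binomialRandom (Fin n) (edgeProb k n)).real
      {G | vertexConnectivity G < k}) atTop (𝓝 0) := by
  set c : ℝ := 2 * (k.factorial * 2 ^ (k - 1) * Real.exp 15) with hc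
  have hinv : Tendsto (fun n : ℕ => (Real.log n)⁻¹) atTop (𝓝 0) :=
    tendsto_log_natCast_atTop.inv_tendsto_atTop
  have hpow : Tendsto (fun n : ℕ => (n : ℝ) ^ (2 * k + 1) * Real.exp (-n)) atTop (𝓝 0) :=
    (Real.tendsto_pow_mul_exp_neg_atTop_nhds_zero (2 * k + 1)).comp tendsto_natCast_atTop_atTop
  have hlim : Tendsto (fun n : ℕ => (k : ℝ) *
      (c * (Real.log n)⁻¹ + (n : ℝ) ^ (2 * k + 1) * Real.exp (-n))) atTop (𝓝 0) := by
    simpa using ((hinv.const_mul c).add hpow).const_mul (k : ℝ)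
  refine squeeze_zero' (Eventually.of_forall fun n => MeasureTheory.measureReal_nonneg) ?_ hlim
  have hr : ∀ᶠ n : ℕ in atTop, Real.exp 15 * (Real.log n)⁻¹ < 1 / 2 := by
    have := hinv.const_mul (Real.exp 15)
    rw [mul_zero] at this
    exact this.eventually_lt_const (by norm_num)
  have hkL : ∀ᶠ n : ℕ in atTop, (k : ℝ) * (Real.log n ^ 1 / n) < 1 := by
    have := (tendsto_log_pow_div_natCast 1).const_mul (k : ℝ)
    rw [mul_zero] at this
    exact this.eventually_lt_const one_pos
  filter_upwards [eventually_edgeDensity_eq k, eventually_coe_edgeProb k, hr, hkL,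
    tendsto_log_natCast_atTop.eventually_ge_atTop 1,
    tendsto_loglog_natCast_atTop.eventually_ge_atTop 1, eventually_ge_atTop (3 * k)]
    with n hx hp hr hkL hL hLL hn
  obtain ⟨x, hx, hx1, hx2, hexp⟩ := hx
  rw [hx] at hp
  have hnpos : 0 < n := by omega
  have hn0 : (0 : ℝ) < n := by exact_mod_cast hnpos
  have hxn : x / n ≤ 1 := hp ▸ (edgeProb k n).2.2
  have hL0 : 0 < Real.log n := by linarith
  have hkL' : Real.log n * k ≤ n := by
    rw [pow_one, mul_div_assoc', div_lt_one hn0] at hkL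
    linarith
  set r : ℝ := Real.exp 15 * Real.log (Real.log n) / Real.log n ^ (k + 1) with hrdef
  have hr0 : 0 ≤ r := by positivity
  have hLLL : Real.log (Real.log n) ≤ Real.log n := Real.log_le_self hL0.le
  -- Two spare powers of `log n` remain: one absorbs `log log n`, the other gives the decay.
  have hrle : r * Real.log n ^ (k - 1) ≤ Real.exp 15 * (Real.log n)⁻¹ := by
    have hpk : Real.log n ^ (k + 1) = Real.log n ^ (k - 1) * (Real.log n * Real.log n) := by
      rw [← sq, ← pow_add]; congr 1; omega
    have : r * Real.log n ^ (k - 1) =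
        Real.exp 15 * (Real.log (Real.log n) / (Real.log n * Real.log n)) := by
      rw [hrdef, hpk]; field_simp
    rw [this]
    gcongr
    rw [div_le_iff₀ (by positivity)]
    rwa [inv_mul_cancel_left₀ hL0.ne']
  have hrhalf : r ≤ 1 / 2 := by
    have : r ≤ r * Real.log n ^ (k - 1) := le_mul_of_one_le_right hr0 (one_le_pow₀ hL)
    linarith
  set K : ℝ := k.factorial * (2 * Real.log n) ^ (k - 1) with hK
  have hK0 : 0 ≤ K := by positivity
  have hmain := measureReal_vertexConnectivity_lt_le (V := Fin n) (edgeProb k n) k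
    (by rw [Fintype.card_fin]; omega)
  rw [Fintype.card_fin, hp] at hmain
  refine hmain.trans ?_
  have hinner : ∀ s ∈ Finset.range k,
      ∑ a ∈ (Finset.Icc 1 n).filter (fun a => 2 * a + s ≤ n), (n.choose a : ℝ) * (n.choose s *
        ((a * (x / n)) ^ s * (1 - x / n) ^ (a * (n - s - a)))) ≤
      c * (Real.log n)⁻¹ + (n : ℝ) ^ (2 * k + 1) * Real.exp (-n) := by
    intro s hs
    rw [Finset.mem_range] at hs
    calc _ ≤ ∑ a ∈ (Finset.Icc 1 n).filter (fun a => 2 * a + s ≤ n),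
          (K * r ^ a + (n : ℝ) ^ (2 * k) * Real.exp (-n)) := by
          refine Finset.sum_le_sum fun a ha => ?_
          obtain ⟨ha1, ha2⟩ := Finset.mem_filter.1 ha
          rcases le_total (a * Real.log n) (6 * n) with h | h
          · exact (separation_term_le_of_small hs hnpos (Finset.mem_Icc.1 ha1).1 ha2 hL hx1 hx2
              hxn hkL' hexp h).trans (le_add_of_nonneg_right (by positivity))
          · exact (separation_term_le_of_large hs hnpos ha2 hL hx1 hxn hn h).trans
              (le_add_of_nonneg_left (by positivity))
      _ ≤ ∑ a ∈ Finset.Icc 1 n, (K * r ^ a + (n : ℝ) ^ (2 * k) * Real.exp (-n)) :=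
          Finset.sum_le_sum_of_subset_of_nonneg (Finset.filter_subset _ _)
            fun _ _ _ => by positivity
      _ = K * ∑ a ∈ Finset.Icc 1 n, r ^ a + (n : ℝ) ^ (2 * k + 1) * Real.exp (-n) := by
          rw [Finset.sum_add_distrib, ← Finset.mul_sum, Finset.sum_const, nsmul_eq_mul,
            Nat.card_Icc, Nat.add_sub_cancel]
          ring
      _ ≤ K * (2 * r) + (n : ℝ) ^ (2 * k + 1) * Real.exp (-n) := by
          gcongr
          exact sum_Icc_pow_le hr0 hrhalf n
      _ = 2 * (k.factorial * 2 ^ (k - 1)) * (r * Real.log n ^ (k - 1)) +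
          (n : ℝ) ^ (2 * k + 1) * Real.exp (-n) := by rw [hK, mul_pow]; ring
      _ ≤ 2 * (k.factorial * 2 ^ (k - 1)) * (Real.exp 15 * (Real.log n)⁻¹) +
          (n : ℝ) ^ (2 * k + 1) * Real.exp (-n) := by gcongr
      _ = _ := by rw [hc]; ring
  refine (Finset.sum_le_card_nsmul _ _ _ hinner).trans (le_of_eq ?_)
  rw [nsmul_eq_mul, Finset.card_range]

end Separations

/-! ### Vertices of degree `k + 1` exist -/

section LowDegree

/-- `(1 - p)(1 + p + 2p^2) = 1 + p^2 (1 - 2p) ≥ 1`, combined with `1 + t ≤ exp t`. -/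
theorem exp_neg_mul_le_one_sub_pow {p : ℝ} (hp0 : 0 ≤ p) (hp : p ≤ 1 / 2) (n : ℕ) :
    Real.exp (-(n * (p + 2 * p ^ 2))) ≤ (1 - p) ^ n := by
  have h1 : 0 < 1 - p := by linarith
  have h2 : Real.exp (-(p + 2 * p ^ 2)) ≤ 1 - p := by
    rw [Real.exp_neg, inv_le_comm₀ (Real.exp_pos _) h1]
    refine le_trans ?_ (Real.add_one_le_exp _)
    rw [inv_le_iff_one_le_mul₀ h1]
    nlinarith [mul_nonneg (mul_nonneg hp0 hp0) (by linarith : (0 : ℝ) ≤ 1 - 2 * p)]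
  calc _ = Real.exp (-(p + 2 * p ^ 2)) ^ n := by rw [← Real.exp_nat_mul]; congr 1; ring
    _ ≤ _ := pow_le_pow_left₀ (Real.exp_pos _).le h2 n

/-- The expected number of vertices of degree `k + 1` in one half of the vertex set, with all
neighbours in the other half, is at least a constant multiple of `log log n`. -/
theorem eventually_le_expected_low_degree (k : ℕ) : ∀ᶠ n : ℕ in atTop,
    Real.exp (-1) / (4 ^ (k + 2) * (k + 1).factorial) * Real.log (Real.log n) ≤
      ((n / 2 : ℕ) : ℝ) * (n / 2).choose (k + 1) *
        ((edgeProb k n : ℝ) ^ (k + 1) * (1 - edgeProb k n) ^ (n - 1 - (k + 1))) := by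
  have hsq : ∀ᶠ n : ℕ in atTop, Real.log n ^ 2 / n < 1 / 8 :=
    (tendsto_log_pow_div_natCast 2).eventually_lt_const (by norm_num)
  have hhalf : ∀ᶠ n : ℕ in atTop, (edgeProb k n : ℝ) < 1 / 2 :=
    (tendsto_coe_edgeProb k).eventually_lt_const (by norm_num)
  filter_upwards [eventually_edgeDensity_eq k, eventually_coe_edgeProb k, hsq, hhalf,
    tendsto_log_natCast_atTop.eventually_ge_atTop 1,
    tendsto_loglog_natCast_atTop.eventually_ge_atTop 1, eventually_ge_atTop (8 * (k + 1))]
    with n hx hp hsq hhalf hL hLL hn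
  obtain ⟨x, hx, hx1, hx2, hexp⟩ := hx
  rw [hx] at hp
  rw [hp] at hhalf ⊢
  have hn0 : (0 : ℝ) < n := by exact_mod_cast (by omega : 0 < n)
  have hL0 : 0 < Real.log n := by linarith
  have hx0 : 0 < x := by linarith
  have hxn0 : 0 ≤ x / n := by positivity
  have hU : (n : ℝ) / 4 ≤ ((n / 2 : ℕ) : ℝ) := by
    have : (n : ℝ) ≤ 4 * ((n / 2 : ℕ) : ℝ) := by exact_mod_cast (by omega : n ≤ 4 * (n / 2))
    linarith
  have hC : ((n : ℝ) / 4) ^ (k + 1) / (k + 1).factorial ≤ ((n / 2).choose (k + 1) : ℝ) := by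
    rw [div_le_iff₀ (by positivity), mul_comm]
    have h1 : ((n / 2 + 1 - (k + 1) : ℕ) : ℝ) ^ (k + 1) ≤
        (k + 1).factorial * ((n / 2).choose (k + 1) : ℝ) := by
      exact_mod_cast Nat.pow_sub_le_descFactorial (n / 2) (k + 1) |>.trans
        (Nat.descFactorial_eq_factorial_mul_choose _ _).le
    refine le_trans ?_ h1
    have : (n : ℝ) ≤ 4 * ((n / 2 + 1 - (k + 1) : ℕ) : ℝ) := by
      exact_mod_cast (by omega : n ≤ 4 * (n / 2 + 1 - (k + 1)))
    gcongr
    linarith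
  -- The quadratic error is `2 x^2 / n ≤ 8 (log n)^2 / n`, eventually below 1; this is the source of
  -- `exp (-1)`.
  have hE : Real.exp (-1) * Real.exp (-x) ≤ (1 - x / n) ^ (n - 1 - (k + 1)) := by
    calc Real.exp (-1) * Real.exp (-x) ≤ Real.exp (-(n * (x / n + 2 * (x / n) ^ 2))) := by
          rw [← Real.exp_add, Real.exp_le_exp]
          have e : n * (x / n + 2 * (x / n) ^ 2) = x + 2 * (x ^ 2 / n) := by field_simp
          have h1 : x ^ 2 / n ≤ 4 * (Real.log n ^ 2 / n) := by
            rw [mul_div_assoc']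
            gcongr
            nlinarith
          rw [e]
          linarith
      _ ≤ (1 - x / n) ^ n := exp_neg_mul_le_one_sub_pow hxn0 hhalf.le n
      _ ≤ _ := pow_le_pow_of_le_one (by linarith) (by linarith) (by omega)
  -- With `p ≥ log n / n` the powers of `n` combine to `n (log n)^(k+1) exp (-x) = log log n`; the
  -- `k + 2` factors `1/4` come from the halves.
  calc Real.exp (-1) / (4 ^ (k + 2) * (k + 1).factorial) * Real.log (Real.log n)
      = (n / 4) * ((n / 4) ^ (k + 1) / (k + 1).factorial) *
          ((Real.log n / n) ^ (k + 1) * (Real.exp (-1) * Real.exp (-x))) := by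
        rw [hexp, div_pow, div_pow]
        field_simp
        ring
    _ ≤ _ := by gcongr

theorem tendsto_measureReal_lt_vertexConnectivity (k : ℕ) :
    Tendsto (fun n : ℕ => (SimpleGraph.binomialRandom (Fin n) (edgeProb k n)).real
      {G | k + 1 < vertexConnectivity G}) atTop (𝓝 0) := by
  set c : ℝ := Real.exp (-1) / (4 ^ (k + 2) * (k + 1).factorial) with hc
  have hc0 : 0 < c := by positivity
  have hlim : Tendsto (fun n : ℕ => 1 / (c * Real.log (Real.log n)) +
      (edgeProb k n : ℝ) / (1 - edgeProb k n)) atTop (𝓝 0) := by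
    have h1 : Tendsto (fun n : ℕ => 1 / (c * Real.log (Real.log n))) atTop (𝓝 0) := by
      simp_rw [one_div]
      exact (tendsto_loglog_natCast_atTop.const_mul_atTop hc0).inv_tendsto_atTop
    have h2 := (tendsto_coe_edgeProb k).div ((tendsto_coe_edgeProb k).const_sub 1) (by norm_num)
    simpa using h1.add h2
  refine squeeze_zero' (Eventually.of_forall fun n => MeasureTheory.measureReal_nonneg) ?_ hlim
  filter_upwards [eventually_le_expected_low_degree k,
    (tendsto_coe_edgeProb k).eventually_lt_const one_pos,
    tendsto_loglog_natCast_atTop.eventually_ge_atTop 1, eventually_ge_atTop (k + 3)]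
    with n hM hp hLL hn
  have hpos : 0 < c * Real.log (Real.log n) := by positivity
  obtain ⟨U, -, hU⟩ := Finset.exists_subset_card_eq (s := (Finset.univ : Finset (Fin n)))
    (n := n / 2) (by rw [Finset.card_univ, Fintype.card_fin]; omega)
  obtain ⟨W, hWU, hW⟩ := Finset.exists_subset_card_eq (s := Uᶜ) (n := n / 2)
    (by rw [Finset.card_compl, Fintype.card_fin, hU]; omega)
  have hUW : Disjoint U W := disjoint_compl_right.mono_right hWU
  have h := measureReal_lt_vertexConnectivity_le (edgeProb k n) hp hUW (d := k + 1)
    (by rw [Fintype.card_fin]; omega) (hpos.trans_le hM) (by rw [hU, hW, Fintype.card_fin])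
  refine h.trans ?_
  gcongr

end LowDegree

/-! ### Combining the two tails -/

theorem lemma7 (k : ℕ) (hk : 1 ≤ k) :
    Tendsto
      (fun n : ℕ => SimpleGraph.binomialRandom (Fin n) (edgeProb k n)
        {G : SimpleGraph (Fin n) | k ≤ vertexConnectivity G ∧ vertexConnectivity G ≤ k + 1})
      atTop (𝓝 1) := by
  rw [← ENNReal.tendsto_toReal_iff (fun _ => MeasureTheory.measure_ne_top _ _) ENNReal.one_ne_top,
    ENNReal.toReal_one]
  have hlow := tendsto_measureReal_vertexConnectivity_lt k hk
  have hhigh := tendsto_measureReal_lt_vertexConnectivity k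
  have hlim : Tendsto (fun n : ℕ => 1 -
      ((SimpleGraph.binomialRandom (Fin n) (edgeProb k n)).real {G | vertexConnectivity G < k} +
      (SimpleGraph.binomialRandom (Fin n) (edgeProb k n)).real
        {G | k + 1 < vertexConnectivity G})) atTop (𝓝 1) := by
    simpa using (hlow.add hhigh).const_sub 1
  refine tendsto_of_tendsto_of_tendsto_of_le_of_le hlim tendsto_const_nhds (fun n => ?_)
    fun n => MeasureTheory.measureReal_le_one
  set μ := SimpleGraph.binomialRandom (Fin n) (edgeProb k n)
  change 1 - _ ≤ μ.real _
  have hcompl := MeasureTheory.probReal_compl_eq_one_sub (μ := μ) (measurableSet_simpleGraph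
    {G : SimpleGraph (Fin n) | k ≤ vertexConnectivity G ∧ vertexConnectivity G ≤ k + 1})
  have hunion := MeasureTheory.measureReal_union_le (μ := μ)
    {G : SimpleGraph (Fin n) | vertexConnectivity G < k}
    {G : SimpleGraph (Fin n) | k + 1 < vertexConnectivity G}
  have heq : {G : SimpleGraph (Fin n) | k ≤ vertexConnectivity G ∧
      vertexConnectivity G ≤ k + 1}ᶜ = {G : SimpleGraph (Fin n) | vertexConnectivity G < k} ∪
      {G : SimpleGraph (Fin n) | k + 1 < vertexConnectivity G} := by
    ext G
    simp only [Set.mem_compl_iff, Set.mem_ofPred_eq, Set.mem_union]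
    omega
  rw [heq] at hcompl
  linarith
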